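/- Let $U$ and $n_t$ be positive integers. Call $(L/K,p,\sigma)$ suitable (for $U$ and $n_t$) if $K\subset\mathbb{C}$ is an imaginary quadratic field of class number $1$; $L\subset\mathbb{C}$ is a cyclic Galois extension of $K$ of degree $Un_t$ with $L=K(\alpha)$ for some $\alpha\in\mathbb{R}$; $\sigma$ is a generator of $\mathrm{Gal}(L/K)$; and $p\in\mathcal{O}_K$ is a prime element that is inert in $L/K$, i.e. $p\mathcal{O}_L$ is a prime ideal. For suitable $(L/K,p,\sigma)$ put $\tau=\sigma^U$, and for $x_1,\dots,x_{n_t}\in\mathcal{O}_L$ let $M(x_1,\dots,x_{n_t})$ be the $n_t\times n_t$ matrix whose entry in row $r$ and column $c$ ($1\le r,c\le n_t$) is $\tau^{c-1}(x_{r-c+1})$ if $c\le r$ and $p\,\tau^{c-1}(x_{n_t+r-c+1})$ if $c>r$. For an integer $m>\frac{U(n_t-1)}{2}$ let $C_{U,n_t}(L/K,p,\sigma,m)$ be the set of all $Un_t\times Un_t$ complex block matrices with $U\times U$ blocks of size $n_t\times n_t$ whose block in position $(j,k)$ is $\sigma^{k-1}(M_j)$ if $k\ne j$ and $p^{-m}\sigma^{j-1}(M_j)$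 if $k=j$, where $M_j=M(x_{j,1},\dots,x_{j,n_t})$ with $x_{j,1},\dots,x_{j,n_t}\in\mathcal{O}_L$ not all zero, for each $j=1,\dots,U$ (automorphisms act entrywise). Let $$\mathfrak{C}_{U,n_t}=\{\,C_{U,n_t}(L/K,p,\sigma,m) : (L/K,p,\sigma)\text{ suitable},\ m\in\mathbb{Z},\ m>\tfrac{U(n_t-1)}{2}\,\}.$$ Then $\mathfrak{C}_{U,n_t}\neq\emptyset$ for all positive integers $U$ and $n_t$; that is, suitable $L/K$, $p$, $\sigma$ and $m$ always exist. -/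

import Mathlib

open scoped NumberField

noncomputable section

namespace MACCode

/-- The data `K`, `L/K`, `p`, `σ` are suitable for `U` users with `n` transmit antennas each:
`K ⊆ ℂ` is an imaginary quadratic field of class number one, `L ⊆ ℂ` is a cyclic Galois extension
of `K` of degree `U * n` of the form `L = K(α)` with `α` real, `σ` generates `Gal(L/K)`, and `p` is
a prime element of the ring of integers of `K` which is inert in `L/K`. -/
structure IsSuitable (U n : ℕ) (K : Subfield ℂ) [NumberField K] (L : IntermediateField K ℂ)
    (p : 𝓞 K) (σ : L ≃ₐ[K] L) : Prop where
  quadratic : Module.finrank ℚ K = 2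
  imaginary : ∃ z ∈ K, z.im ≠ 0
  classNumber_eq_one : NumberField.classNumber K = 1
  galois : IsGalois K L
  degree : Module.finrank K L = U * n
  real_generator : ∃ α : ℝ, L = IntermediateField.adjoin K {(α : ℂ)}
  generator : ∀ g : L ≃ₐ[K] L, g ∈ Subgroup.zpowers σ
  prime : Prime p
  inert : ((Ideal.span {p}).map (algebraMap (𝓞 K) (𝓞 L))).IsPrime

variable {K : Subfield ℂ} {L : IntermediateField K ℂ}

/-- The matrix `M(x₁, …, xₙ)` of the left regular representation of
`x₁ + u x₂ + ⋯ + uⁿ⁻¹ xₙ` in the cyclic algebra `(L/F, τ, p)`, where `uⁿ = p`. With rows, columns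
and coefficients indexed from `0`, the entry at `(r, c)` is `τ^c (x (r - c))` on and below the
diagonal and `p * τ^c (x (n + r - c))` above it; the subtraction in `Fin n` is modulo `n`. -/
def regRep {n : ℕ} (p : 𝓞 K) (τ : L ≃ₐ[K] L) (x : Fin n → 𝓞 L) : Matrix (Fin n) (Fin n) L :=
  Matrix.of fun r c =>
    (if c ≤ r then 1 else algebraMap K L (p : K)) * (τ ^ (c : ℕ)) ((x (r - c) : 𝓞 L) : L)

/-- The `n × (U n)` matrix `B_j = (M, σ(M), …, p⁻ᵐ σʲ(M), …, σ^(U-1)(M))` of the `j`-th user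
(users are indexed from `0`), where `M = M(x₁, …, xₙ)` is formed with `τ = σ ^ U`. The column
index `(k, c)` stands for column `c` of the `k`-th block. -/
def userMatrix (U n : ℕ) (p : 𝓞 K) (σ : L ≃ₐ[K] L) (m : ℤ) (j : Fin U) (x : Fin n → 𝓞 L) :
    Matrix (Fin n) (Fin U × Fin n) ℂ :=
  Matrix.of fun r kc =>
    (if kc.1 = j then ((p : K) : ℂ) ^ (-m) else 1) *
      (((σ ^ (kc.1 : ℕ)) (regRep p (σ ^ U) x r kc.2) : L) : ℂ)

/-- The code of the `j`-th user: all matrices `B_j` with `(x₁, …, xₙ) ≠ 0`. -/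
def userCode (U n : ℕ) (p : 𝓞 K) (σ : L ≃ₐ[K] L) (m : ℤ) (j : Fin U) :
    Set (Matrix (Fin n) (Fin U × Fin n) ℂ) :=
  {B | ∃ x : Fin n → 𝓞 L, (∃ l, x l ≠ 0) ∧ B = userMatrix U n p σ m j x}

/-- The whole code `C_{U,n}(L/K, p, σ, m)`: all block matrices obtained by stacking
`B_1, …, B_U` with `B_j` in the code of the `j`-th user. The row index `(j, r)` stands for row `r`
of the `j`-th block. -/
def code (U n : ℕ) (p : 𝓞 K) (σ : L ≃ₐ[K] L) (m : ℤ) :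
    Set (Matrix (Fin U × Fin n) (Fin U × Fin n) ℂ) :=
  {A | ∀ j : Fin U, (Matrix.of fun r kc => A (j, r) kc) ∈ userCode U n p σ m j}

/-- The family of all codes `C_{U,n}(L/K, p, σ, m)` with suitable `L/K`, `p`, `σ` and a rational
integer `m > U (n - 1) / 2`. -/
def codeFamily (U n : ℕ) : Set (Set (Matrix (Fin U × Fin n) (Fin U × Fin n) ℂ)) :=
  {C | ∃ (K : Subfield ℂ) (_ : NumberField K) (L : IntermediateField K ℂ) (p : 𝓞 K)
      (σ : L ≃ₐ[K] L) (m : ℤ), IsSuitable U n K L p σ ∧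
        (U : ℚ) * ((n : ℚ) - 1) / 2 < (m : ℚ) ∧ C = code U n p σ m}

end MACCode

end

/-!
Take a prime `q ≡ 1 (mod U n)`, `q > 3`, `K = ℚ(ζ₃)` and `M = K(ζ_q) = ℚ(ζ_{3q})`. By Dirichlet's
theorem there is a prime `l ≡ 1 (mod 3)` which is a primitive root modulo `q`. A prime `P` of `M`
above `l` has residue degree `q - 1 = [M : K]` over `ℚ` and lies over a prime `(p)` of `K` of
residue degree `1`, so `N(P) = N(p)^[M : K] = N(p 𝓞_M)` and hence `p 𝓞_M = P`: the element `p` is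
inert in `M / K`. Everything passes to the subextension `L / K` of degree `U n` of the cyclic
extension `M / K`. Since `L` is abelian over `ℚ` it is stable under complex conjugation, and as it
contains a nonreal element of `K`, its real elements span it over `K`; a primitive element of its
real subfield over `ℚ` therefore generates `L` over `K`.
-/

namespace MACCode

theorem exists_prime_orderOf_natCast_eq_totient {m n : ℕ} [NeZero m] [NeZero n]
    [IsCyclic (ZMod n)ˣ] (h : m.Coprime n) :
    ∃ l : ℕ, l.Prime ∧ ¬ l ∣ m * n ∧ (l : ZMod m) = 1 ∧
      orderOf (l : ZMod (m * n)) = n.totient := by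
  obtain ⟨g, hg⟩ := IsCyclic.exists_ofOrder_eq_natCard (α := (ZMod n)ˣ)
  let e := ZMod.chineseRemainder h
  have hunit : IsUnit (e.symm (1, (g : ZMod n))) :=
    (Prod.isUnit_iff.2 ⟨isUnit_one, g.isUnit⟩).map e.symm
  obtain ⟨l, hlt, hl, hle⟩ := Nat.forall_exists_prime_gt_and_eq_mod hunit (m * n)
  have hel : e (l : ZMod (m * n)) = (1, (g : ZMod n)) := by rw [hle, e.apply_symm_apply]
  refine ⟨l, hl, Nat.not_dvd_of_pos_of_lt (NeZero.pos _) hlt, ?_, ?_⟩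
  · simpa only [map_natCast, Prod.fst_natCast] using congrArg Prod.fst hel
  · calc orderOf (l : ZMod (m * n)) = orderOf (e (l : ZMod (m * n))) :=
          (orderOf_injective e.toMonoidHom e.injective _).symm
      _ = orderOf g := by rw [hel, Prod.orderOf, orderOf_one, Nat.lcm_one_left, orderOf_units]
      _ = n.totient := by rw [hg, Nat.card_eq_fintype_card, ZMod.card_units_eq_totient]

theorem isPrime_map_of_tower {A B C : Type*} [CommRing A] [CommRing B] [CommRing C]
    [Algebra A B] [Algebra A C] [Algebra B C] [IsScalarTower A B C] [Module.FaithfullyFlat B C]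
    {I : Ideal A} (h : (I.map (algebraMap A C)).IsPrime) : (I.map (algebraMap A B)).IsPrime := by
  rw [IsScalarTower.algebraMap_eq A B C, ← Ideal.map_map] at h
  rw [← Ideal.comap_map_eq_self_of_faithfullyFlat (B := C) (I.map (algebraMap A B))]
  exact h.comap _

theorem map_under_eq_of_absNorm_eq (R : Type*) {S : Type*} [CommRing R] [IsDedekindDomain R]
    [Module.Free ℤ R] [Module.Finite ℤ R] [CommRing S] [IsDedekindDomain S] [Module.Free ℤ S]
    [Algebra R S] [Module.Finite R S] [Module.IsTorsionFree R S] {P : Ideal S} (hP : P ≠ ⊥)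
    (h : Ideal.absNorm P = Ideal.absNorm (P.under R) ^ Module.finrank R S) :
    (P.under R).map (algebraMap R S) = P := by
  have : Module.Finite ℤ S := .trans R S
  obtain ⟨J, hJ⟩ := Ideal.dvd_iff_le.2 (Ideal.map_comap_le : (P.under R).map (algebraMap R S) ≤ P)
  have hnorm := Ideal.absNorm_algebraMap R (S := S) (P.under R)
  rw [← h, hJ, map_mul] at hnorm
  have hJ1 : Ideal.absNorm J = 1 :=
    (Nat.mul_eq_left (Ideal.absNorm_eq_zero_iff.not.2 hP)).1 hnorm
  rw [hJ, Ideal.absNorm_eq_one_iff.1 hJ1, Ideal.mul_top]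

theorem exists_intermediateField_finrank_eq {F E : Type*} [Field F] [Field E] [Algebra F E]
    [FiniteDimensional F E] [IsGalois F E] [IsCyclic (E ≃ₐ[F] E)] {d : ℕ}
    (hd : d ∣ Module.finrank F E) :
    ∃ L : IntermediateField F E, Module.finrank F L = d := by
  obtain ⟨g, hg⟩ := IsCyclic.exists_ofOrder_eq_natCard (α := E ≃ₐ[F] E)
  rw [IsGalois.card_aut_eq_finrank] at hg
  have hd0 : d ≠ 0 := ne_zero_of_dvd_ne_zero Module.finrank_pos.ne' hd
  let H := Subgroup.zpowers (g ^ d)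
  have hH : Nat.card H = Module.finrank F E / d := by
    rw [Nat.card_zpowers, orderOf_pow_of_dvd hd0 (hg ▸ hd), hg]
  refine ⟨IntermediateField.fixedField H, ?_⟩
  have htower := Module.finrank_mul_finrank F (IntermediateField.fixedField H) E
  rw [IntermediateField.finrank_fixedField_eq_card, hH] at htower
  refine Nat.eq_of_mul_eq_mul_right ?_ (htower.trans (Nat.mul_div_cancel' hd).symm)
  exact Nat.div_pos (Nat.le_of_dvd Module.finrank_pos hd) (Nat.pos_of_ne_zero hd0)

theorem exists_intermediateField_le_finrank_eq {F E : Type*} [Field F] [Field E] [Algebra F E]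
    (M : IntermediateField F E) [FiniteDimensional F M] [IsGalois F M] [IsCyclic (M ≃ₐ[F] M)]
    {d : ℕ} (hd : d ∣ Module.finrank F M) : ∃ L ≤ M, Module.finrank F L = d := by
  obtain ⟨L, hL⟩ := exists_intermediateField_finrank_eq hd
  exact ⟨IntermediateField.lift L, IntermediateField.lift_le L,
    (IntermediateField.liftAlgEquiv L).toLinearEquiv.finrank_eq.symm.trans hL⟩

theorem isCyclotomicExtension_lcm_of_tower (m n : ℕ) [NeZero m] [NeZero n] (A B C : Type*)
    [CommRing A] [CommRing B] [CommRing C] [Algebra A B] [Algebra A C] [Algebra B C]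
    [IsScalarTower A B C] [FaithfulSMul B C] [hm : IsCyclotomicExtension {m} A B]
    [hn : IsCyclotomicExtension {n} B C] : IsCyclotomicExtension {m.lcm n} A C := by
  have hinj := FaithfulSMul.algebraMap_injective B C
  obtain ⟨ζ, hζ⟩ := hm.exists_isPrimitiveRoot rfl (NeZero.ne m)
  obtain ⟨ξ, hξ⟩ := hn.exists_isPrimitiveRoot rfl (NeZero.ne n)
  have hroot := (hζ.map_of_injective hinj).pow_mul_pow_lcm hξ (NeZero.ne m) (NeZero.ne n)
  have hlcm : m.lcm n ≠ 0 := Nat.lcm_ne_zero (NeZero.ne m) (NeZero.ne n)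
  have : NeZero (m.lcm n) := ⟨hlcm⟩
  have := IsCyclotomicExtension.trans {m} {n} A B C hinj
  have := IsCyclotomicExtension.union_of_isPrimitiveRoot ({m} ∪ {n}) A C hroot
  rwa [IsCyclotomicExtension.iff_union_of_dvd (S := {m.lcm n}) A C
      ⟨_, rfl, hlcm, Nat.dvd_lcm_left m n⟩,
    IsCyclotomicExtension.iff_union_of_dvd A C ⟨_, Or.inl rfl, hlcm, Nat.dvd_lcm_right m n⟩,
    Set.union_assoc, Set.union_comm]

section CyclotomicDegree

variable {m n : ℕ} [NeZero m] [NeZero n] (K M : Type*) [Field K] [Field M]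

variable (n) in
theorem isCyclic_gal_of_isCyclic_units [Algebra K M] [IsCyclic (ZMod n)ˣ]
    [IsCyclotomicExtension {n} K M] : IsCyclic (M ≃ₐ[K] M) :=
  have hζ := IsCyclotomicExtension.zeta_spec n K M
  isCyclic_of_injective (hζ.autToPow K) (hζ.autToPow_injective K)

variable [CharZero K]

variable (n) in
theorem finrank_rat_eq_totient [IsCyclotomicExtension {n} ℚ K] :
    Module.finrank ℚ K = n.totient :=
  IsCyclotomicExtension.finrank K (Polynomial.cyclotomic.irreducible_rat (NeZero.pos n))

variable [CharZero M]

theorem isCyclotomicExtension_mul_of_tower [Algebra K M] [IsCyclotomicExtension {m} ℚ K]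
    [IsCyclotomicExtension {n} K M] (h : m.Coprime n) : IsCyclotomicExtension {m * n} ℚ M :=
  h.lcm_eq_mul ▸ isCyclotomicExtension_lcm_of_tower m n ℚ K M

theorem finrank_eq_totient_of_coprime [Algebra K M] [IsCyclotomicExtension {m} ℚ K]
    [IsCyclotomicExtension {n} K M] (h : m.Coprime n) : Module.finrank K M = n.totient := by
  have := isCyclotomicExtension_mul_of_tower K M h
  have htower := Module.finrank_mul_finrank ℚ K M
  rw [finrank_rat_eq_totient m K, finrank_rat_eq_totient (m * n) M, Nat.totient_mul h] at htower
  exact Nat.eq_of_mul_eq_mul_left (Nat.totient_pos.2 (NeZero.pos m)) htower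

theorem isAbelianGalois_rat_of_coprime [Algebra K M] [IsCyclotomicExtension {m} ℚ K]
    [IsCyclotomicExtension {n} K M] (h : m.Coprime n) : IsAbelianGalois ℚ M :=
  have := isCyclotomicExtension_mul_of_tower K M h
  IsCyclotomicExtension.isAbelianGalois {m * n} ℚ M

end CyclotomicDegree

section InertPrime

variable {m n : ℕ} [NeZero m] [NeZero n] (K M : Type*) [Field K] [NumberField K] [Field M]
  [NumberField M]

variable (n) in
theorem absNorm_eq_pow_orderOf [IsCyclotomicExtension {n} ℚ M] {l : ℕ} (hl : l.Prime)
    (hln : ¬ l ∣ n) (P : Ideal (𝓞 M)) [P.IsPrime] [P.LiesOver (Ideal.span {(l : ℤ)})] :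
    Ideal.absNorm P = l ^ orderOf (l : ZMod n) := by
  have : Fact l.Prime := ⟨hl⟩
  rw [← IsCyclotomicExtension.Rat.inertiaDeg_eq_of_not_dvd l M P hln, Ideal.pow_inertiaDeg]

theorem exists_isPrime_and_isPrime_map (h : m.Coprime n) [IsCyclic (ZMod n)ˣ]
    [Algebra K M] [IsCyclotomicExtension {m} ℚ K] [IsCyclotomicExtension {n} K M] :
    ∃ 𝔭 : Ideal (𝓞 K), 𝔭 ≠ ⊥ ∧ 𝔭.IsPrime ∧ (𝔭.map (algebraMap (𝓞 K) (𝓞 M))).IsPrime := by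
  have := isCyclotomicExtension_mul_of_tower K M h
  obtain ⟨l, hl, hlmn, hlm, hord⟩ := exists_prime_orderOf_natCast_eq_totient h
  have hlℤ : Prime (l : ℤ) := Nat.prime_iff_prime_int.1 hl
  have : (Ideal.span {(l : ℤ)}).IsPrime := (Ideal.span_singleton_prime hlℤ.ne_zero).2 hlℤ
  obtain ⟨⟨P, hP, hPl⟩⟩ := (Ideal.span {(l : ℤ)}).nonempty_primesOver (S := 𝓞 M)
  have hnormM : Ideal.absNorm P = l ^ n.totient := by
    rw [absNorm_eq_pow_orderOf (m * n) M hl hlmn P, hord]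
  have hnormK : Ideal.absNorm (P.under (𝓞 K)) = l := by
    rw [absNorm_eq_pow_orderOf m K hl (fun hdvd => hlmn (hdvd.mul_right n)), hlm, orderOf_one,
      pow_one]
  have hdeg : Module.finrank (𝓞 K) (𝓞 M) = n.totient := by
    rw [← finrank_eq_totient_of_coprime K M h, IsFractionRing.finrank_eq (𝓞 K) K (𝓞 M) M]
  have hP0 : P ≠ ⊥ := Ideal.absNorm_eq_zero_iff.not.1 (hnormM ▸ pow_ne_zero _ hl.ne_zero)
  refine ⟨P.under (𝓞 K), Ideal.absNorm_eq_zero_iff.not.1 (hnormK ▸ hl.ne_zero), inferInstance, ?_⟩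
  rwa [map_under_eq_of_absNorm_eq (𝓞 K) hP0 (by rw [hnormM, hnormK, hdeg])]

theorem exists_prime_and_isPrime_map_span (h : m.Coprime n) [IsCyclic (ZMod n)ˣ]
    [Algebra K M] [IsCyclotomicExtension {m} ℚ K] [IsCyclotomicExtension {n} K M]
    [IsPrincipalIdealRing (𝓞 K)] :
    ∃ p : 𝓞 K, Prime p ∧ ((Ideal.span {p}).map (algebraMap (𝓞 K) (𝓞 M))).IsPrime := by
  obtain ⟨𝔭, h0, hprime, hmap⟩ := exists_isPrime_and_isPrime_map K M h
  rw [← Ideal.span_singleton_generator 𝔭] at h0 hprime hmap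
  refine ⟨_, (Ideal.span_singleton_prime fun hp => h0 ?_).1 hprime, hmap⟩
  rw [hp, Ideal.span_singleton_eq_bot]

end InertPrime

theorem exists_intermediateField_isCyclotomicExtension (n : ℕ) (F : Type*) [Field F]
    [Algebra F ℂ] : ∃ M : IntermediateField F ℂ, IsCyclotomicExtension {n} F M :=
  ⟨_, IntermediateField.isCyclotomicExtension_adjoin_of_exists_isPrimitiveRoot {n} F ℂ
    fun k _ hk => ⟨_, Complex.isPrimitiveRoot_exp k hk⟩⟩

theorem exists_subfield_isCyclotomicExtension (n : ℕ) :
    ∃ K : Subfield ℂ, IsCyclotomicExtension {n} ℚ K := by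
  obtain ⟨L, hL⟩ := exists_intermediateField_isCyclotomicExtension n ℚ
  refine ⟨L.toSubfield, ?_⟩
  rwa [Subsingleton.elim DivisionRing.toRatAlgebra L.algebra']

variable {K : Subfield ℂ}

theorem exists_mem_im_ne_zero [NumberField.IsTotallyComplex K] : ∃ z ∈ K, z.im ≠ 0 := by
  by_contra! hreal
  refine NumberField.IsTotallyComplex.complexEmbedding_not_isReal K.subtype ?_
  exact RingHom.ext fun z => Complex.conj_eq_iff_im.2 (hreal z z.2)

theorem conj_mem_of_normal {L : IntermediateField K ℂ} [Normal ℚ L] {x : ℂ} (hx : x ∈ L) :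
    starRingEnd ℂ x ∈ L := by
  let φ : ℂ →ₐ[ℚ] ℂ := Complex.conjAe.toAlgHom.restrictScalars ℚ
  have h := φ.restrictNormal_commutes L ⟨x, hx⟩
  exact h ▸ (φ.restrictNormal L ⟨x, hx⟩).2

theorem exists_eq_ofReal_add_ofReal_mul {L : IntermediateField K ℂ} [Normal ℚ L] {z : ℂ}
    (hz : z ∈ L) (hzim : z.im ≠ 0) {x : ℂ} (hx : x ∈ L) :
    ∃ a b : ℝ, (a : ℂ) ∈ L ∧ (b : ℂ) ∈ L ∧ x = a + b * z := by
  have hb : ((x.im / z.im : ℝ) : ℂ) = (x - starRingEnd ℂ x) / (z - starRingEnd ℂ z) := by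
    rw [Complex.sub_conj, Complex.sub_conj, mul_div_mul_right _ _ Complex.I_ne_zero,
      Complex.ofReal_mul, Complex.ofReal_mul]
    push_cast
    rw [mul_div_mul_left _ _ two_ne_zero]
  have ha : ((x.re - x.im / z.im * z.re : ℝ) : ℂ) = x - (x.im / z.im : ℝ) * z := by
    apply Complex.ext <;> simp [hzim]
  have hbL : ((x.im / z.im : ℝ) : ℂ) ∈ L := by
    rw [hb]
    exact div_mem (sub_mem hx (conj_mem_of_normal hx)) (sub_mem hz (conj_mem_of_normal hz))
  refine ⟨_, _, ?_, hbL, by rw [ha, sub_add_cancel]⟩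
  rw [ha]
  exact sub_mem hx (mul_mem hbL hz)

theorem exists_real_forall_mem_adjoin (L : IntermediateField K ℂ)
    [FiniteDimensional ℚ L] : ∃ α : ℝ, (α : ℂ) ∈ L ∧
      ∀ r : ℝ, (r : ℂ) ∈ L → (r : ℂ) ∈ IntermediateField.adjoin K {(α : ℂ)} := by
  let R : Subfield ℝ := L.toSubfield.comap Complex.ofRealHom
  let ι : R →+* L := (Complex.ofRealHom.comp R.subtype).codRestrict L fun r => r.2
  have : FiniteDimensional ℚ R :=
    FiniteDimensional.of_injective ι.toRatAlgHom.toLinearMap ι.injective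
  obtain ⟨α, hα⟩ := Field.exists_primitive_element ℚ R
  let g : R →ₐ[ℚ] ℂ := (Complex.ofRealHom.comp R.subtype).toRatAlgHom
  have hle : (⊤ : IntermediateField ℚ R).map g ≤
      (IntermediateField.adjoin K {g α}).restrictScalars ℚ := by
    rw [← hα, IntermediateField.adjoin_map, Set.image_singleton,
      IntermediateField.adjoin_le_iff, Set.singleton_subset_iff]
    exact IntermediateField.mem_adjoin_simple_self K (g α)
  exact ⟨α, α.2, fun r hr => hle ⟨⟨r, hr⟩, trivial, rfl⟩⟩

theorem exists_real_generator (L : IntermediateField K ℂ) [FiniteDimensional ℚ L]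
    [Normal ℚ L] (hK : ∃ z ∈ K, z.im ≠ 0) :
    ∃ α : ℝ, L = IntermediateField.adjoin K {(α : ℂ)} := by
  obtain ⟨z, hz, hzim⟩ := hK
  obtain ⟨α, hαL, hα⟩ := exists_real_forall_mem_adjoin L
  refine ⟨α, le_antisymm (fun x hx => ?_) ?_⟩
  · obtain ⟨a, b, ha, hb, rfl⟩ :=
      exists_eq_ofReal_add_ofReal_mul (L.algebraMap_mem ⟨z, hz⟩) hzim hx
    exact add_mem (hα a ha) (mul_mem (hα b hb) (algebraMap_mem _ (⟨z, hz⟩ : K)))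
  · exact IntermediateField.adjoin_simple_le_iff.2 hαL

variable [NumberField K]

theorem IsSuitable.exists_of_dvd {M : IntermediateField K ℂ} [NumberField M]
    [IsAbelianGalois ℚ M] {U n U' n' : ℕ} {p : 𝓞 K} {τ : M ≃ₐ[K] M}
    (hM : IsSuitable U' n' K M p τ) (hdvd : U * n ∣ U' * n') :
    ∃ (L : IntermediateField K ℂ) (σ : L ≃ₐ[K] L), IsSuitable U n K L p σ := by
  have := hM.galois
  have : IsCyclic (M ≃ₐ[K] M) := ⟨τ, hM.generator⟩
  obtain ⟨L, hLM, hdeg⟩ := exists_intermediateField_le_finrank_eq M (hM.degree ▸ hdvd)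
  let := (IntermediateField.inclusion hLM).toRingHom.toAlgebra
  have : IsScalarTower K L M := .of_algebraMap_eq fun _ => rfl
  have : FiniteDimensional K L := .left K L M
  have : NumberField L := .of_module_finite K L
  have : IsAbelianGalois ℚ L := .tower_bot ℚ L M
  have : IsAbelianGalois K L := .tower_top ℚ K L
  have : IsCyclic (L ≃ₐ[K] L) := isCyclic_of_surjective (AlgEquiv.restrictNormalHom L)
    (AlgEquiv.restrictNormalHom_surjective (F := K) M)
  obtain ⟨σ, hσ⟩ := IsCyclic.exists_generator (α := L ≃ₐ[K] L)
  exact ⟨L, σ, { hM with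
    galois := inferInstance
    degree := hdeg
    real_generator := exists_real_generator L hM.imaginary
    generator := hσ
    inert := isPrime_map_of_tower hM.inert }⟩

theorem exists_isSuitable_of_isCyclotomicExtension [IsCyclotomicExtension {3} ℚ K] {q : ℕ}
    [Fact q.Prime] (hq : 3 < q) (M : IntermediateField K ℂ) [IsCyclotomicExtension {q} K M] :
    ∃ (p : 𝓞 K) (σ : M ≃ₐ[K] M), IsSuitable 1 (q - 1) K M p σ := by
  have hcop : Nat.Coprime 3 q := (Nat.coprime_primes Nat.prime_three Fact.out).2 hq.ne
  have : NumberField M := IsCyclotomicExtension.numberField {q} K M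
  have : IsAbelianGalois ℚ M := isAbelianGalois_rat_of_coprime K M hcop
  have : IsPrincipalIdealRing (𝓞 K) := IsCyclotomicExtension.Rat.three_pid K
  have : NumberField.IsTotallyComplex K :=
    IsCyclotomicExtension.Rat.isTotallyComplex K (n := 3) (by norm_num)
  have : IsCyclic (M ≃ₐ[K] M) := isCyclic_gal_of_isCyclic_units q K M
  obtain ⟨p, hp, hinert⟩ := exists_prime_and_isPrime_map_span K M hcop
  obtain ⟨σ, hσ⟩ := IsCyclic.exists_generator (α := M ≃ₐ[K] M)
  have himag : ∃ z ∈ K, z.im ≠ 0 := exists_mem_im_ne_zero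
  exact ⟨p, σ, {
    quadratic := finrank_rat_eq_totient 3 K
    imaginary := himag
    classNumber_eq_one := NumberField.classNumber_eq_one_iff.2 inferInstance
    galois := IsCyclotomicExtension.isGalois {q} K M
    degree := by
      rw [finrank_eq_totient_of_coprime K M hcop, Nat.totient_prime Fact.out, one_mul]
    real_generator := exists_real_generator M himag
    generator := hσ
    prime := hp
    inert := hinert }⟩

end MACCode

theorem mainTheorem8 (U n : ℕ) (hU : 0 < U) (hn : 0 < n) :
    MACCode.codeFamily U n ≠ ∅ := by
  obtain ⟨q, hq, h3, hmod⟩ := Nat.exists_prime_gt_modEq_one (k := U * n) 3 (by positivity)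
  have : Fact q.Prime := ⟨hq⟩
  have hdvd : U * n ∣ 1 * (q - 1) := by
    rw [one_mul]
    exact (Nat.modEq_iff_dvd' hq.one_le).1 hmod.symm
  obtain ⟨K, _⟩ := MACCode.exists_subfield_isCyclotomicExtension 3
  have : NumberField K := IsCyclotomicExtension.numberField {3} ℚ K
  obtain ⟨M, _⟩ := MACCode.exists_intermediateField_isCyclotomicExtension q K
  have : NumberField M := IsCyclotomicExtension.numberField {q} K M
  have : IsAbelianGalois ℚ M := MACCode.isAbelianGalois_rat_of_coprime K M
    ((Nat.coprime_primes Nat.prime_three hq).2 h3.ne)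
  obtain ⟨p, τ, hM⟩ := MACCode.exists_isSuitable_of_isCyclotomicExtension h3 M
  obtain ⟨L, σ, hL⟩ := hM.exists_of_dvd hdvd
  obtain ⟨m, hm⟩ := exists_int_gt ((U : ℚ) * ((n : ℚ) - 1) / 2)
  exact Set.nonempty_iff_ne_empty.1 ⟨_, K, ‹_›, L, p, σ, m, hL, hm, rfl⟩
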